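/- Let $\alpha>1$ and $0<\theta<1$ with $\alpha\theta>1$. For $x\in\mathbb R$ and $s>0$ let $$u_{2\alpha}(x,s)=\frac{1}{2(\alpha s)^{1/\alpha}}\left[\mathrm{Ai}_\alpha\!\left(\frac{x}{(\alpha s)^{1/\alpha}}\right)+\mathrm{Ai}_\alpha\!\left(-\frac{x}{(\alpha s)^{1/\alpha}}\right)\right],\qquad \mathrm{Ai}_\alpha(x)=\frac1\pi\lim_{R\to\infty}\int_0^{R}\cos\!\left(rx+\frac{r^\alpha}{\alpha}\right)dr,$$ be the pseudo-density of the (fractional) Fresnel pseudoprocess $F_{2\alpha}$; that is, $F_{2\alpha}$ is described by the finitely additive signed measure given on cylinders, for $0=t_0<t_1<\dots<t_m$, $x_0=0$ and $a_j\le b_j$, by $$\mathbb P\Big(\bigcap_{j=1}^m\{a_j\le F_{2\alpha}(t_j)\le b_j\}\Big)=\int_{a_1}^{b_1}\!\!\cdots\int_{a_m}^{b_m}\prod_{j=1}^m u_{2\alpha}(x_j-x_{j-1},t_j-t_{j-1})\,dx_m\cdots dx_1 .$$ Let $(S_\theta(t))_{t\ge0}$ be a stable subordinator of exponent $\theta$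 on a probability space (a process started at $0$ with independent stationary increments and a.s. nondecreasing right-continuous paths), independent of $F_{2\alpha}$, with $$\mathbb E\left[e^{i\gamma S_\theta(t)}\right]=e^{-t|\gamma|^\theta e^{-i\frac{\pi\theta}{2}\operatorname{sgn}\gamma}},\qquad \gamma\in\mathbb R,\ t\ge 0 .$$ The pseudo-law of $F_{2\alpha}(S_\theta(t))$ is obtained by conditioning on the independent time $S_\theta(t)$: $$\mathbb P\big(a\le F_{2\alpha}(S_\theta(t))\le b\big)=\mathbb E\big[\,\mathbb P(a\le F_{2\alpha}(s)\le b)\big|_{s=S_\theta(t)}\big],\qquad a\le b .$$ Theorem. For every $t>0$ and $a\le b$ the expectation defining $\mathbb P(a\le F_{2\alpha}(S_\theta(t))\le b)$ converges absolutely, and this pseudo-law has the continuous density $x\mapsto\mathbb E[u_{2\alpha}(x,S_\theta(t))]$ with respect to Lebesgue measure, where the expectation converges absolutely for every $x$. For every $x\in\mathbb R$ this pseudo-density is given by the convergent power series $$\frac{\mathbb P\left(F_{2\alpha}(S_\theta(t))\in dx\right)}{dx}=\mathbb E\left[u_{2\alpha}(x,S_\theta(t))\right]=\frac{1}{\alpha\theta\pi\,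 t^{\frac{1}{\alpha\theta}}}\sum_{k=0}^{\infty}\left(\frac{x}{t^{\frac{1}{\alpha\theta}}}\right)^{2k}\frac{\Gamma\left(\frac{2k+1}{\alpha\theta}\right)}{(2k)!}\sin\left(\pi\frac{(2k+1)(\alpha+1)}{2\alpha}\right).$$ -/

import Mathlib

open MeasureTheory ProbabilityTheory Filter Topology
open scoped NNReal

/-- The generalized Airy function
`Ai_α(x) = (1/π) ∫_0^∞ cos (s x + s^α / α) ds`, where the integral is the (conditionally convergent)
improper integral, i.e. the limit as `R → ∞` of the integrals over `[0, R]`. -/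
noncomputable def genAiry (α x : ℝ) : ℝ :=
  (1 / Real.pi) *
    limUnder atTop (fun R : ℝ => ∫ s in (0 : ℝ)..R, Real.cos (s * x + s ^ α / α))

/-- The pseudo-density `u_{2α}(x, s)` of the fractional Fresnel pseudoprocess at time `s > 0`. -/
noncomputable def fresnelDensity (α x s : ℝ) : ℝ :=
  1 / (2 * (α * s) ^ (1 / α)) *
    (genAiry α (x / (α * s) ^ (1 / α)) + genAiry α (-(x / (α * s) ^ (1 / α))))

/-- The (finitely additive, signed) pseudo-measure of the fractional Fresnel pseudoprocess on the
cylinder `{a_j ≤ F(τ_j) ≤ b_j, j = 1, …, m}`, for times `0 < τ_1 < ⋯ < τ_m`: the integral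
over the box `∏_j [a_j, b_j]` of `∏_j u_{2α}(x_j - x_{j-1}, τ_j - τ_{j-1})`, with
`τ_0 = 0` and `x_0 = 0`. -/
noncomputable def fresnelCylinder (α : ℝ) {m : ℕ} (τ a b : Fin m → ℝ) : ℝ :=
  ∫ x in Set.Icc a b, ∏ j : Fin m,
    fresnelDensity α
      (x j - (Fin.cons 0 x : Fin (m + 1) → ℝ) j.castSucc)
      (τ j - (Fin.cons 0 τ : Fin (m + 1) → ℝ) j.castSucc)

/-- The one-time pseudo-probability `P(a ≤ F_{2α}(s) ≤ b)`. -/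
noncomputable def fresnelProb (α s a b : ℝ) : ℝ :=
  fresnelCylinder α (fun _ : Fin 1 => s) (fun _ => a) (fun _ => b)

/-- The one-time pseudo-probabilities are the integrals of `u_{2α}(·, s)`. -/
theorem fresnelProb_eq (α s a b : ℝ) :
    fresnelProb α s a b = ∫ x in Set.Icc a b, fresnelDensity α x s := by
  have h := (volume_preserving_funUnique (Fin 1) ℝ).setIntegral_preimage_emb
    (MeasurableEquiv.measurableEmbedding _) (fun x => fresnelDensity α x s) (Set.Icc a b)
  rw [← h]
  have hs : (MeasurableEquiv.funUnique (Fin 1) ℝ) ⁻¹' Set.Icc a b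
      = Set.Icc (fun _ : Fin 1 => a) (fun _ => b) := by
    ext x
    simp [Pi.le_def, MeasurableEquiv.funUnique]
  rw [hs]
  simp [fresnelProb, fresnelCylinder, MeasurableEquiv.funUnique]
  rfl

/-- A subordinator: a real-valued process `(S_t)_{t ≥ 0}` started at `0`, with independent and
stationary increments and almost surely nondecreasing, right-continuous paths. -/
structure IsSubordinator {Ω : Type*} [MeasurableSpace Ω] (S : ℝ≥0 → Ω → ℝ) (P : Measure Ω) :
    Prop where
  measurable : ∀ t, Measurable (S t)
  start_zero : ∀ᵐ ω ∂P, S 0 ω = 0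
  indep_increments : HasIndepIncrements S P
  stationary_increments : ∀ s t, IdentDistrib (fun ω => S (s + t) ω - S s ω) (S t) P P
  monotone_paths : ∀ᵐ ω ∂P, Monotone (fun t => S t ω)
  rightContinuous_paths :
    ∀ᵐ ω ∂P, ∀ t, ContinuousWithinAt (fun r => S r ω) (Set.Ici t) t

/-- A stable subordinator of exponent `θ`: a subordinator with
`E[exp(iγ S_t)] = exp(-t |γ|^θ exp(-i (πθ/2) sgn γ))` for all `t ≥ 0` and real `γ`. -/
structure IsStableSubordinator {Ω : Type*} [MeasurableSpace Ω] (θ : ℝ) (S : ℝ≥0 → Ω → ℝ)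
    (P : Measure Ω) : Prop extends IsSubordinator S P where
  charFun_eq : ∀ (t : ℝ≥0) (γ : ℝ),
    ∫ ω, Complex.exp (Complex.I * γ * S t ω) ∂P =
      Complex.exp (-((t : ℝ) : ℂ) * ((|γ| ^ θ : ℝ) : ℂ) *
        Complex.exp (-Complex.I * ((Real.pi * θ / 2 * Real.sign γ : ℝ) : ℂ)))

/-- The pseudo-probability `P(a ≤ F_{2α}(S_t) ≤ b)` for an independent random time `S_t = T`:
the pseudo-law of `F_{2α}` at the random time is obtained by conditioning on `T`. -/
noncomputable def subordinatedFresnelProb {Ω : Type*} [MeasurableSpace Ω] (α : ℝ) (T : Ω → ℝ)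
    (P : Measure Ω) (a b : ℝ) : ℝ :=
  ∫ ω, fresnelProb α (T ω) a b ∂P

/-- The value at `x` of the pseudo-density of `F_{2α}(T)`, `T` an independent random time with
law `h`: the mixture `∫ u_{2α}(x, s) h(ds)`, that is `E[u_{2α}(x, T)]`. -/
noncomputable def subordinatedFresnelDensity {Ω : Type*} [MeasurableSpace Ω] (α : ℝ) (T : Ω → ℝ)
    (P : Measure Ω) (x : ℝ) : ℝ :=
  ∫ ω, fresnelDensity α x (T ω) ∂P

/-!
Rescaling the integration variable in the generalized Airy functions by `(α s)^{1/α}` and adding the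
two terms gives, for `s > 0`,
`u_{2α}(x, s) = (1/π) ∫_0^∞ cos (q x) cos (s q^α) dq`, a conditionally convergent integral
(`tendsto_fresnelPartial`). Taking the expectation under the integral sign replaces `cos (s q^α)`
by the real part of the characteristic function of `S_θ(t)` at `γ = q^α`, that is by
`Re exp (-t e^{-iπθ/2} q^{αθ})`, which is absolutely integrable because `cos (πθ/2) > 0`. The
resulting function of `x` is `stableCosTransform`
(`subordinatedFresnelDensity_eq_stableCosTransform`).

The exchange is justified by a uniform bound on the partial integrals over `[0, n]`. The phase
`q x + s q^α` is convex for `q > 0`, and its derivative exceeds `1` from an abscissa of order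
`s^{-1/(α-1)}` on; the first-derivative van der Corput estimate bounds the integral beyond that
point, and the trivial bound serves before it (`abs_fresnelPartial_le`). So it suffices that
`S_θ(t)` has finite negative moments. They come from its Laplace transform `exp (-t l^θ)`, which is
recovered from the characteristic function by the Phragmén–Lindelöf principle in the half-plane
(`complexMGF_neg_eq_of_charFun`) and then integrated against `l^{p-1} dl`
(`integrable_rpow_neg_of_laplace`). The same bound is uniform for `x` in a bounded interval, so
Fubini's theorem identifies the density of the pseudo-law.

Finally, since `αθ > 1`, the cosine series can be integrated term by term against
`Re exp (-t e^{-iπθ/2} q^{αθ})`, and each term is Euler's integral with a complex parameter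
(`hasSum_stableCosTransform`); this also yields the convergence of the power series.
-/

/-! ### The Fresnel density as an oscillatory integral -/

/-- First-derivative van der Corput estimate: integrate `cos φ = (1 / φ') (sin φ)'` by parts. -/
theorem abs_intervalIntegral_cos_le {φ φ' φ'' : ℝ → ℝ} {A B : ℝ} (hAB : A ≤ B)
    (hφ : ∀ q ∈ Set.Icc A B, HasDerivAt φ (φ' q) q)
    (hφ' : ∀ q ∈ Set.Icc A B, HasDerivAt φ' (φ'' q) q)
    (hc : ContinuousOn φ'' (Set.Icc A B)) (hpos : ∀ q ∈ Set.Icc A B, 0 < φ' q)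
    (hnn : ∀ q ∈ Set.Icc A B, 0 ≤ φ'' q) :
    |∫ q in A..B, Real.cos (φ q)| ≤ 2 / φ' A := by
  have hu : Set.uIcc A B = Set.Icc A B := Set.uIcc_of_le hAB
  have cφ : ContinuousOn φ (Set.Icc A B) := fun q hq => (hφ q hq).continuousAt.continuousWithinAt
  have cφ' : ContinuousOn φ' (Set.Icc A B) := fun q hq =>
    (hφ' q hq).continuousAt.continuousWithinAt
  have hne : ∀ q ∈ Set.Icc A B, φ' q ^ 2 ≠ 0 := fun q hq => (pow_pos (hpos q hq) 2).ne'
  have i1 : IntervalIntegrable (fun q => Real.cos (φ q)) volume A B :=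
    ContinuousOn.intervalIntegrable (by rw [hu]; exact Real.continuous_cos.comp_continuousOn cφ)
  have i3 : IntervalIntegrable (fun q => φ'' q / φ' q ^ 2) volume A B :=
    ContinuousOn.intervalIntegrable (by rw [hu]; exact hc.div (cφ'.pow 2) hne)
  have i2 : IntervalIntegrable (fun q => Real.sin (φ q) * (φ'' q / φ' q ^ 2)) volume A B :=
    ContinuousOn.intervalIntegrable (by
      rw [hu]
      exact (Real.continuous_sin.comp_continuousOn cφ).mul (hc.div (cφ'.pow 2) hne))
  have e1 : ∫ q in A..B, (Real.cos (φ q) - Real.sin (φ q) * (φ'' q / φ' q ^ 2)) =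
      Real.sin (φ B) / φ' B - Real.sin (φ A) / φ' A := by
    refine intervalIntegral.integral_eq_sub_of_hasDerivAt
      (f := fun q => Real.sin (φ q) / φ' q) (fun q hq => ?_) (i1.sub i2)
    rw [hu] at hq
    have h := ((hφ q hq).sin).div (hφ' q hq) (hpos q hq).ne'
    refine h.congr_deriv ?_
    have := (hpos q hq).ne'
    field_simp
  have e3 : ∫ q in A..B, φ'' q / φ' q ^ 2 = 1 / φ' A - 1 / φ' B := by
    have : ∫ q in A..B, φ'' q / φ' q ^ 2 = -(φ' B)⁻¹ - -(φ' A)⁻¹ := by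
      refine intervalIntegral.integral_eq_sub_of_hasDerivAt
        (f := fun q => -(φ' q)⁻¹) (fun q hq => ?_) i3
      rw [hu] at hq
      refine ((hφ' q hq).inv (hpos q hq).ne').neg.congr_deriv ?_
      ring
    rw [this]; ring
  have e2 : |∫ q in A..B, Real.sin (φ q) * (φ'' q / φ' q ^ 2)| ≤ 1 / φ' A - 1 / φ' B := by
    rw [← e3, ← Real.norm_eq_abs]
    refine intervalIntegral.norm_integral_le_of_norm_le hAB (ae_of_all _ fun q hq => ?_) i3
    have hq' : q ∈ Set.Icc A B := Set.Ioc_subset_Icc_self hq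
    have h0 : 0 ≤ φ'' q / φ' q ^ 2 := div_nonneg (hnn q hq') (sq_nonneg _)
    rw [norm_mul, Real.norm_eq_abs, Real.norm_eq_abs, abs_of_nonneg h0]
    exact mul_le_of_le_one_left h0 (Real.abs_sin_le_one _)
  rw [intervalIntegral.integral_sub i1 i2] at e1
  have b : ∀ q ∈ Set.Icc A B, |Real.sin (φ q) / φ' q| ≤ 1 / φ' q := fun q hq => by
    rw [abs_div, abs_of_pos (hpos q hq)]
    exact div_le_div_of_nonneg_right (Real.abs_sin_le_one _) (hpos q hq).le
  have bA := abs_le.1 (b A ⟨le_rfl, hAB⟩)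
  have bB := abs_le.1 (b B ⟨hAB, le_rfl⟩)
  have b2 := abs_le.1 e2
  have h2 : 2 / φ' A = 1 / φ' A + 1 / φ' A := by ring
  rw [h2, abs_le]
  constructor <;> linarith [bA.1, bA.2, bB.1, bB.2, b2.1, b2.2]

theorem abs_intervalIntegral_cos_rpow_le {α s x A B : ℝ} (hα : 1 < α) (hs : 0 < s) (hA : 0 < A)
    (hAB : A ≤ B) (hpos : 0 < x + s * (α * A ^ (α - 1))) :
    |∫ q in A..B, Real.cos (q * x + s * q ^ α)| ≤ 2 / (x + s * (α * A ^ (α - 1))) := by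
  have hq0 : ∀ q ∈ Set.Icc A B, 0 < q := fun q hq => hA.trans_le hq.1
  refine abs_intervalIntegral_cos_le (φ := fun q => q * x + s * q ^ α)
    (φ' := fun q => x + s * (α * q ^ (α - 1)))
    (φ'' := fun q => s * (α * ((α - 1) * q ^ (α - 1 - 1)))) hAB ?_ ?_ ?_ ?_ ?_
  · intro q hq
    have h := ((hasDerivAt_id q).mul_const x).add
      ((Real.hasDerivAt_rpow_const (p := α) (Or.inl (hq0 q hq).ne')).const_mul s)
    simpa using! h
  · intro q hq
    exact (((Real.hasDerivAt_rpow_const (p := α - 1) (Or.inl (hq0 q hq).ne')).const_mul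
      α).const_mul s).const_add x
  · intro q hq
    have := (Real.continuousAt_rpow_const q (α - 1 - 1) (Or.inl (hq0 q hq).ne'))
    exact ((((this.const_mul (α - 1))).const_mul α).const_mul s).continuousWithinAt
  · intro q hq
    refine hpos.trans_le ?_
    have := Real.rpow_le_rpow hA.le hq.1 (by linarith : 0 ≤ α - 1)
    gcongr
  · intro q hq
    have := Real.rpow_nonneg (hq0 q hq).le (α - 1 - 1)
    have : 0 ≤ α - 1 := by linarith
    positivity

theorem continuous_cos_rpow_phase {α : ℝ} (hα : 1 < α) (x s : ℝ) :
    Continuous fun q : ℝ => Real.cos (q * x + s * q ^ α) := by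
  have : Continuous fun q : ℝ => q ^ α := Real.continuous_rpow_const (by linarith)
  fun_prop

/-- The partial integrals are bounded uniformly in `R`, by a constant plus a negative power of
`s`: from the abscissa `q₀ = ((M + 1) / (s α))^{1/(α-1)}` on, the derivative of the phase is at least
`1` and the first-derivative estimate applies; below it the integrand is bounded by `1`. -/
theorem abs_partialIntegral_le {α s x M R : ℝ} (hα : 1 < α) (hs : 0 < s) (hx : |x| ≤ M)
    (hR : 0 ≤ R) :
    |∫ q in (0 : ℝ)..R, Real.cos (q * x + s * q ^ α)| ≤
      ((M + 1) / (s * α)) ^ (1 / (α - 1)) + 2 := by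
  have hM : 0 ≤ M := (abs_nonneg x).trans hx
  have hα1 : 0 < α - 1 := by linarith
  have hb : 0 < (M + 1) / (s * α) := by positivity
  -- At `q0` the derivative of `s q^α` equals `M + 1`, so the derivative of the phase is at least `1`.
  set q0 := ((M + 1) / (s * α)) ^ (1 / (α - 1)) with hq0
  have hq0p : 0 < q0 := Real.rpow_pos_of_pos hb _
  have triv : ∀ T : ℝ, 0 ≤ T → |∫ q in (0 : ℝ)..T, Real.cos (q * x + s * q ^ α)| ≤ T := by
    intro T hT
    have := intervalIntegral.norm_integral_le_of_norm_le_const (a := 0) (b := T) (C := 1)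
      (f := fun q => Real.cos (q * x + s * q ^ α)) (fun q _ => Real.abs_cos_le_one _)
    simpa [abs_of_nonneg hT] using this
  rcases le_total R q0 with h | h
  · linarith [triv R hR]
  · have hpow : s * (α * q0 ^ (α - 1)) = M + 1 := by
      rw [hq0, ← Real.rpow_mul hb.le, one_div, inv_mul_cancel₀ hα1.ne', Real.rpow_one]
      field_simp
    have hge : 1 ≤ x + s * (α * q0 ^ (α - 1)) := by
      rw [hpow]; linarith [(abs_le.1 hx).1]
    have h1 := abs_intervalIntegral_cos_rpow_le hα hs hq0p h (x := x) (by linarith)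
    have h2 : 2 / (x + s * (α * q0 ^ (α - 1))) ≤ 2 := div_le_self (by norm_num) hge
    have hc := continuous_cos_rpow_phase hα x s
    rw [← intervalIntegral.integral_add_adjacent_intervals (hc.intervalIntegrable 0 q0)
      (hc.intervalIntegrable q0 R)]
    exact (abs_add_le _ _).trans (by linarith [triv q0 hq0p.le])

/-- The derivative of the phase tends to infinity, so the first-derivative estimate gives
Cauchy's criterion. -/
theorem exists_tendsto_partialIntegral {α s : ℝ} (hα : 1 < α) (hs : 0 < s) (x : ℝ) :
    ∃ l, Tendsto (fun R : ℝ => ∫ q in (0 : ℝ)..R, Real.cos (q * x + s * q ^ α)) atTop (𝓝 l) := by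
  refine cauchySeq_tendsto_of_complete (Metric.cauchySeq_iff'.2 fun ε hε => ?_)
  have hlim : Tendsto (fun A : ℝ => x + s * (α * A ^ (α - 1))) atTop atTop := by
    refine tendsto_atTop_add_const_left _ _ (Tendsto.const_mul_atTop hs
      (Tendsto.const_mul_atTop (by linarith) (tendsto_rpow_atTop (by linarith))))
  obtain ⟨N, hN, hN0⟩ := ((hlim.eventually_gt_atTop (2 / ε)).and (eventually_gt_atTop 0)).exists
  refine ⟨N, fun R hR => ?_⟩
  have hpos : 0 < x + s * (α * N ^ (α - 1)) := lt_trans (by positivity) hN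
  have hc := continuous_cos_rpow_phase hα x s
  rw [Real.dist_eq, intervalIntegral.integral_interval_sub_left (hc.intervalIntegrable 0 R)
    (hc.intervalIntegrable 0 N)]
  refine (abs_intervalIntegral_cos_rpow_le hα hs hN0 hR hpos).trans_lt ?_
  rw [div_lt_iff₀ hpos]
  rw [div_lt_iff₀ hε] at hN
  linarith

/-- The partial integral `(1/π) ∫_0^n cos (q x) cos (s q^α) dq` of the cosine transform that
represents the density `u_{2α}(x, s)`. -/
noncomputable def fresnelPartial (α : ℝ) (n : ℕ) (x s : ℝ) : ℝ :=
  1 / Real.pi * ∫ q in (0 : ℝ)..n, Real.cos (q * x) * Real.cos (s * q ^ α)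

theorem fresnelPartial_eq {α : ℝ} (hα : 1 < α) (n : ℕ) (x s : ℝ) :
    fresnelPartial α n x s = 1 / (2 * Real.pi) *
      ((∫ q in (0 : ℝ)..n, Real.cos (q * x + s * q ^ α)) +
        ∫ q in (0 : ℝ)..n, Real.cos (q * (-x) + s * q ^ α)) := by
  rw [← intervalIntegral.integral_add
    ((continuous_cos_rpow_phase hα x s).intervalIntegrable _ _)
    ((continuous_cos_rpow_phase hα (-x) s).intervalIntegrable _ _), fresnelPartial]
  have : ∀ q : ℝ, Real.cos (q * x + s * q ^ α) + Real.cos (q * (-x) + s * q ^ α) =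
      2 * (Real.cos (q * x) * Real.cos (s * q ^ α)) := by
    intro q
    rw [Real.cos_add, Real.cos_add, mul_neg, Real.cos_neg, Real.sin_neg]
    ring
  simp_rw [this]
  rw [intervalIntegral.integral_const_mul]
  ring

theorem continuous_fresnelPartial {α : ℝ} (hα : 1 < α) (n : ℕ) :
    Continuous fun p : ℝ × ℝ => fresnelPartial α n p.1 p.2 := by
  have h : Continuous fun q : ℝ => q ^ α := Real.continuous_rpow_const (by linarith)
  have := h.comp (continuous_snd (X := ℝ × ℝ))
  exact (intervalIntegral.continuous_parametric_intervalIntegral_of_continuous'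
    (f := fun (p : ℝ × ℝ) q => Real.cos (q * p.1) * Real.cos (p.2 * q ^ α))
    (by unfold Function.uncurry; dsimp only [Function.comp_def] at this; fun_prop) 0 n).const_mul _

theorem abs_fresnelPartial_le {α s x M : ℝ} (hα : 1 < α) (hs : 0 < s) (hx : |x| ≤ M) (n : ℕ) :
    |fresnelPartial α n x s| ≤
      ((M + 1) / α) ^ (1 / (α - 1)) * s ^ (-(1 / (α - 1))) + 2 := by
  have hM : 0 ≤ M := (abs_nonneg x).trans hx
  have h1 := abs_partialIntegral_le hα hs hx (Nat.cast_nonneg n)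
  have h2 := abs_partialIntegral_le hα hs (x := -x) (M := M) (by rwa [abs_neg]) (Nat.cast_nonneg n)
  have e : ((M + 1) / (s * α)) ^ (1 / (α - 1)) =
      ((M + 1) / α) ^ (1 / (α - 1)) * s ^ (-(1 / (α - 1))) := by
    rw [Real.rpow_neg hs.le, ← Real.inv_rpow hs.le,
      ← Real.mul_rpow (by positivity) (by positivity)]
    congr 1
    field_simp
  rw [← e, fresnelPartial_eq hα, abs_mul, abs_of_pos (by positivity)]
  have hpi : 1 / (2 * Real.pi) ≤ 1 / 2 := by
    gcongr
    linarith [Real.pi_gt_three]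
  calc 1 / (2 * Real.pi) * _ ≤ 1 / 2 * (_ + _) :=
        mul_le_mul hpi ((abs_add_le _ _).trans (add_le_add h1 h2)) (abs_nonneg _) (by norm_num)
    _ = _ := by ring

/-- Rescaling `r = (α s)^{1/α} q` turns the phase `r x / (α s)^{1/α} + r^α / α` into
`q x + s q^α`. -/
theorem intervalIntegral_airy_rescale {α s : ℝ} (hα : 1 < α) (hs : 0 < s) (x : ℝ) {R : ℝ}
    (hR : 0 ≤ R) :
    ∫ r in (0 : ℝ)..R * (α * s) ^ (1 / α), Real.cos (r * (x / (α * s) ^ (1 / α)) + r ^ α / α) =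
      (α * s) ^ (1 / α) * ∫ q in (0 : ℝ)..R, Real.cos (q * x + s * q ^ α) := by
  have hαs : 0 < α * s := by positivity
  set c := (α * s) ^ (1 / α) with hc
  have hc0 : 0 < c := Real.rpow_pos_of_pos hαs _
  have hcα : c ^ α = α * s := by
    rw [hc, ← Real.rpow_mul hαs.le, one_div, inv_mul_cancel₀ (by linarith), Real.rpow_one]
  have h := intervalIntegral.integral_comp_mul_left (a := 0) (b := R)
    (fun r => Real.cos (r * (x / c) + r ^ α / α)) hc0.ne'
  rw [smul_eq_mul, mul_zero, eq_inv_mul_iff_mul_eq₀ hc0.ne', mul_comm c R] at h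
  rw [← h]
  congr 1
  refine intervalIntegral.integral_congr fun q hq => ?_
  rw [Set.uIcc_of_le hR] at hq
  rw [Real.mul_rpow hc0.le hq.1, hcα]
  congr 1
  field_simp

theorem tendsto_genAiry {α s : ℝ} (hα : 1 < α) (hs : 0 < s) (x : ℝ) :
    Tendsto (fun n : ℕ => (α * s) ^ (1 / α) / Real.pi *
        ∫ q in (0 : ℝ)..n, Real.cos (q * x + s * q ^ α)) atTop
      (𝓝 (genAiry α (x / (α * s) ^ (1 / α)))) := by
  have hc0 : 0 < (α * s) ^ (1 / α) := Real.rpow_pos_of_pos (by positivity) _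
  have hlim : ∃ l, Tendsto (fun R : ℝ =>
      ∫ r in (0 : ℝ)..R, Real.cos (r * (x / (α * s) ^ (1 / α)) + r ^ α / α)) atTop (𝓝 l) := by
    obtain ⟨l, hl⟩ := exists_tendsto_partialIntegral hα (s := 1 / α) (by positivity)
      (x / (α * s) ^ (1 / α))
    refine ⟨l, hl.congr fun R => ?_⟩
    simp_rw [one_div_mul_eq_div]
  have h := (tendsto_nhds_limUnder hlim).comp
    (tendsto_natCast_atTop_atTop (R := ℝ).atTop_mul_const hc0)
  refine (h.const_mul (1 / Real.pi)).congr fun n => ?_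
  rw [Function.comp_apply, intervalIntegral_airy_rescale hα hs x (Nat.cast_nonneg n)]
  ring

theorem tendsto_fresnelPartial {α s : ℝ} (hα : 1 < α) (hs : 0 < s) (x : ℝ) :
    Tendsto (fun n => fresnelPartial α n x s) atTop (𝓝 (fresnelDensity α x s)) := by
  have hc0 : 0 < (α * s) ^ (1 / α) := Real.rpow_pos_of_pos (by positivity) _
  have h := ((tendsto_genAiry hα hs x).add (tendsto_genAiry hα hs (-x))).const_mul
    (1 / (2 * (α * s) ^ (1 / α)))
  rw [neg_div] at h
  refine h.congr fun n => ?_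
  rw [fresnelPartial_eq hα]
  generalize (∫ q in (0 : ℝ)..n, Real.cos (q * x + s * q ^ α)) = u
  generalize (∫ q in (0 : ℝ)..n, Real.cos (q * (-x) + s * q ^ α)) = v
  field_simp

theorem abs_fresnelDensity_le {α s x M : ℝ} (hα : 1 < α) (hs : 0 < s) (hx : |x| ≤ M) :
    |fresnelDensity α x s| ≤
      ((M + 1) / α) ^ (1 / (α - 1)) * s ^ (-(1 / (α - 1))) + 2 :=
  le_of_tendsto (tendsto_fresnelPartial hα hs x).abs
    (Eventually.of_forall fun n => abs_fresnelPartial_le hα hs hx n)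

/-! ### Laplace transform and negative moments of the stable law -/

theorem re_cpow_ofReal_nonneg {z : ℂ} (hz : 0 ≤ z.re) {θ : ℝ} (hθ0 : 0 < θ) (hθ1 : θ < 1) :
    0 ≤ (z ^ (θ : ℂ)).re := by
  rw [Complex.cpow_ofReal_re]
  refine mul_nonneg (Real.rpow_nonneg (norm_nonneg _) _) (Real.cos_nonneg_of_mem_Icc ?_)
  have h := abs_le.1 (Complex.abs_arg_le_pi_div_two_iff.2 hz)
  have hpi := Real.pi_pos
  constructor <;> nlinarith [h.1, h.2]

theorem continuousOn_cpow_ofReal_re_nonneg {θ : ℝ} (hθ : 0 < θ) :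
    ContinuousOn (fun z : ℂ => z ^ (θ : ℂ)) {z | 0 ≤ z.re} := by
  intro z hz
  refine ContinuousAt.continuousWithinAt ?_
  by_cases h : z = 0
  · subst h
    have h1 := Complex.continuousAt_cpow_zero_of_re_pos (z := (θ : ℂ)) (by simpa using hθ)
    exact ContinuousAt.comp (f := fun z : ℂ => (z, (θ : ℂ))) (g := fun p : ℂ × ℂ => p.1 ^ p.2)
      (x := 0) h1 (by fun_prop)
  · refine continuousAt_cpow_const ?_
    rcases (show 0 ≤ z.re from hz).lt_or_eq with h1 | h1
    · exact Or.inl h1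
    · exact Or.inr fun h2 => h (Complex.ext h1.symm h2)

theorem ofReal_mul_I_cpow_ofReal {θ : ℝ} (hθ : 0 < θ) (y : ℝ) :
    ((y : ℂ) * Complex.I) ^ (θ : ℂ) = ((|y| ^ θ : ℝ) : ℂ) *
      Complex.exp (Complex.I * ((Real.pi * θ / 2 * Real.sign y : ℝ) : ℂ)) := by
  rcases lt_trichotomy y 0 with h | h | h
  · have e : (y : ℂ) * Complex.I = ((-y : ℝ) : ℂ) * (-Complex.I) := by push_cast; ring
    rw [e, Complex.cpow_def_of_ne_zero (by simp [h.ne]),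
      Complex.log_ofReal_mul (by linarith) (by simp),
      Complex.log_neg_I, add_mul, Complex.exp_add, Real.sign_of_neg h, abs_of_neg h,
      Real.rpow_def_of_pos (by linarith)]
    push_cast
    congr 2
    ring
  · subst h
    simp [hθ.ne', Real.zero_rpow]
  · rw [Complex.cpow_def_of_ne_zero (by simp [h.ne']), Complex.log_ofReal_mul h (by simp),
      Complex.log_I, add_mul, Complex.exp_add, Real.sign_of_pos h, abs_of_pos h,
      Real.rpow_def_of_pos h]
    push_cast
    congr 2
    ring

section Laplace

variable {Ω : Type*} [MeasurableSpace Ω] {P : Measure Ω} [IsProbabilityMeasure P] {T : Ω → ℝ}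

theorem norm_cexp_neg_mul_le_one {z : ℂ} (hz : 0 ≤ z.re) {s : ℝ} (hs : 0 ≤ s) :
    ‖Complex.exp (-z * s)‖ ≤ 1 := by
  rw [Complex.norm_exp, Real.exp_le_one_iff]
  simpa using mul_nonneg hz hs

theorem continuousOn_complexMGF_neg (hT : Measurable T) (hT0 : ∀ᵐ ω ∂P, 0 ≤ T ω) :
    ContinuousOn (fun z => complexMGF T P (-z)) {z | 0 ≤ z.re} := by
  refine continuousOn_of_dominated (bound := fun _ => 1) (fun z _ => ?_) (fun z hz => ?_)
    (integrable_const _) (ae_of_all _ fun ω => ?_)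
  · exact Measurable.aestronglyMeasurable (by fun_prop)
  · filter_upwards [hT0] with ω hω using norm_cexp_neg_mul_le_one hz hω
  · exact Continuous.continuousOn (by fun_prop)

theorem Iic_subset_integrableExpSet (hT : Measurable T) (hT0 : ∀ᵐ ω ∂P, 0 ≤ T ω) :
    Set.Iic 0 ⊆ integrableExpSet T P := by
  intro r hr
  refine Integrable.of_bound (C := 1) (Measurable.aestronglyMeasurable (by fun_prop)) ?_
  filter_upwards [hT0] with ω hω
  rw [Real.norm_eq_abs, Real.abs_exp, Real.exp_le_one_iff]
  exact mul_nonpos_of_nonpos_of_nonneg hr hω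

theorem differentiableOn_complexMGF_neg (hT : Measurable T) (hT0 : ∀ᵐ ω ∂P, 0 ≤ T ω) :
    DifferentiableOn ℂ (fun z => complexMGF T P (-z)) {z | 0 < z.re} := by
  refine differentiableOn_complexMGF.comp differentiable_neg.differentiableOn fun z hz => ?_
  refine interior_mono (Iic_subset_integrableExpSet hT hT0) ?_
  rw [interior_Iic]
  simpa using hz

/-- Both sides are bounded and holomorphic in the right half-plane and agree on its boundary,
where they are given by the characteristic function, so they agree by the Phragmén–Lindelöf
principle. -/
theorem complexMGF_neg_eq_of_charFun {θ t : ℝ} (hθ0 : 0 < θ) (hθ1 : θ < 1) (ht : 0 ≤ t)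
    (hT : Measurable T) (hT0 : ∀ᵐ ω ∂P, 0 ≤ T ω)
    (hchar : ∀ γ : ℝ, ∫ ω, Complex.exp (Complex.I * γ * T ω) ∂P =
      Complex.exp (-(t : ℂ) * ((|γ| ^ θ : ℝ) : ℂ) *
        Complex.exp (-Complex.I * ((Real.pi * θ / 2 * Real.sign γ : ℝ) : ℂ))))
    {z : ℂ} (hz : 0 ≤ z.re) :
    complexMGF T P (-z) = Complex.exp (-(t : ℂ) * z ^ (θ : ℂ)) := by
  set f : ℂ → ℂ := fun z => complexMGF T P (-z) - Complex.exp (-(t : ℂ) * z ^ (θ : ℂ)) with hf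
  have hbd : ∀ w : ℂ, 0 ≤ w.re → ‖f w‖ ≤ 2 := by
    intro w hw
    have h1 : ‖complexMGF T P (-w)‖ ≤ 1 := by
      refine (norm_integral_le_of_norm_le_const (C := 1) ?_).trans (by simp)
      filter_upwards [hT0] with ω hω using norm_cexp_neg_mul_le_one hw hω
    have h2 : ‖Complex.exp (-(t : ℂ) * w ^ (θ : ℂ))‖ ≤ 1 := by
      have := norm_cexp_neg_mul_le_one (re_cpow_ofReal_nonneg hw hθ0 hθ1) ht
      rwa [neg_mul, mul_comm, ← neg_mul] at this
    exact (norm_sub_le _ _).trans (by linarith)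
  have hd : DiffContOnCl ℂ f {z | 0 < z.re} := by
    constructor
    · refine (differentiableOn_complexMGF_neg hT hT0).sub ?_
      refine DifferentiableOn.cexp (DifferentiableOn.const_mul ?_ _)
      intro w hw
      exact (DifferentiableAt.cpow_const differentiableAt_id (Or.inl hw)).differentiableWithinAt
    · rw [Complex.closure_setOfPred_lt_re]
      exact (continuousOn_complexMGF_neg hT hT0).sub
        (((continuousOn_cpow_ofReal_re_nonneg hθ0).const_smul (-(t : ℂ))).cexp)
  have key := PhragmenLindelof.right_half_plane_of_bounded_on_real (C := 0) hd
    ⟨0, by norm_num, 0, ?_⟩ ⟨2, ?_⟩ ?_ hz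
  · exact sub_eq_zero.1 (norm_le_zero_iff.1 key)
  · refine Asymptotics.IsBigO.of_bound 2 ?_
    filter_upwards [mem_inf_of_right (mem_principal_self _)] with w hw
    simpa using hbd w (le_of_lt hw)
  · rw [eventually_map]
    filter_upwards [eventually_ge_atTop 0] with r hr using hbd r (by simpa using hr)
  · intro y
    -- On the imaginary axis `exp (-z T)` is `exp (i γ T)` with `γ = -y`.
    have h := hchar (-y)
    rw [norm_le_zero_iff, sub_eq_zero, ofReal_mul_I_cpow_ofReal hθ0, ← mul_assoc, complexMGF]
    rw [abs_neg, Real.sign_neg] at h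
    convert! h using 4
    · push_cast; ring
    · push_cast; ring

theorem integral_exp_neg_mul_of_charFun {θ t : ℝ} (hθ0 : 0 < θ) (hθ1 : θ < 1) (ht : 0 ≤ t)
    (hT : Measurable T) (hT0 : ∀ᵐ ω ∂P, 0 ≤ T ω)
    (hchar : ∀ γ : ℝ, ∫ ω, Complex.exp (Complex.I * γ * T ω) ∂P =
      Complex.exp (-(t : ℂ) * ((|γ| ^ θ : ℝ) : ℂ) *
        Complex.exp (-Complex.I * ((Real.pi * θ / 2 * Real.sign γ : ℝ) : ℂ))))
    {l : ℝ} (hl : 0 ≤ l) :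
    ∫ ω, Real.exp (-(l * T ω)) ∂P = Real.exp (-t * l ^ θ) := by
  have h := complexMGF_neg_eq_of_charFun hθ0 hθ1 ht hT hT0 hchar (z := l) (by simpa using hl)
  rw [← Complex.ofReal_neg, complexMGF_ofReal, ← Complex.ofReal_cpow hl] at h
  have h' : mgf T P (-l) = Real.exp (-t * l ^ θ) := by exact_mod_cast h
  simpa [mgf] using h'

theorem lintegral_rpow_mul_exp_neg_mul {p s : ℝ} (hp : 0 < p) (hs : 0 < s) :
    ∫⁻ l in Set.Ioi (0 : ℝ), ENNReal.ofReal (l ^ (p - 1) * Real.exp (-(s * l))) =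
      ENNReal.ofReal (s ^ (-p) * Real.Gamma p) := by
  rw [← ofReal_integral_eq_lintegral_ofReal]
  · rw [Real.integral_rpow_mul_exp_neg_mul_Ioi hp hs, one_div, Real.inv_rpow hs.le,
      Real.rpow_neg hs.le]
  · have := integrableOn_rpow_mul_exp_neg_mul_rpow (s := p - 1) (by linarith) one_pos hs
    simpa [IntegrableOn] using! this
  · filter_upwards [ae_restrict_mem measurableSet_Ioi] with l hl
    exact mul_nonneg (Real.rpow_nonneg (le_of_lt hl) _) (Real.exp_nonneg _)

/-- Integrating the Laplace transform against `l^{p-1} dl` shows that a variable with the Laplace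
transform of the stable law has finite moments of every negative order. -/
theorem lintegral_lintegral_rpow_mul_exp_lt_top {θ t : ℝ} (hθ0 : 0 < θ) (ht : 0 < t)
    (hT : Measurable T) (hT0 : ∀ᵐ ω ∂P, 0 ≤ T ω)
    (hL : ∀ l : ℝ, 0 ≤ l → ∫ ω, Real.exp (-(l * T ω)) ∂P = Real.exp (-t * l ^ θ))
    {p : ℝ} (hp : 0 < p) :
    ∫⁻ ω, (∫⁻ l in Set.Ioi (0 : ℝ),
      ENNReal.ofReal (l ^ (p - 1) * Real.exp (-(T ω * l)))) ∂P < ⊤ := by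
  rw [lintegral_lintegral_swap (by unfold Function.uncurry; fun_prop)]
  have hint := integrableOn_rpow_mul_exp_neg_mul_rpow (s := p - 1) (by linarith) hθ0 ht
  refine lt_of_le_of_lt (le_of_eq ?_) hint.lintegral_lt_top
  refine setLIntegral_congr_fun measurableSet_Ioi fun l hl => ?_
  have hl : 0 < l := hl
  have hle : ∀ᵐ ω ∂P, ‖Real.exp (-(l * T ω))‖ ≤ 1 := by
    filter_upwards [hT0] with ω hω
    rw [Real.norm_eq_abs, Real.abs_exp, Real.exp_le_one_iff, neg_nonpos]
    exact mul_nonneg hl.le hω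
  have hi : Integrable (fun ω => l ^ (p - 1) * Real.exp (-(T ω * l))) P := by
    simp_rw [mul_comm (T _) l]
    exact (Integrable.of_bound (Measurable.aestronglyMeasurable (by fun_prop)) 1 hle).const_mul _
  rw [← ofReal_integral_eq_lintegral_ofReal hi, integral_const_mul]
  · simp_rw [mul_comm (T _) l]
    rw [hL l hl.le]
  · exact ae_of_all _ fun ω => mul_nonneg (Real.rpow_nonneg hl.le _) (Real.exp_nonneg _)

/-- There is no atom at `0`: there the inner integral of
`lintegral_lintegral_rpow_mul_exp_lt_top` would be infinite. -/
theorem ae_pos_of_laplace {θ t : ℝ} (hθ0 : 0 < θ) (ht : 0 < t)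
    (hT : Measurable T) (hT0 : ∀ᵐ ω ∂P, 0 ≤ T ω)
    (hL : ∀ l : ℝ, 0 ≤ l → ∫ ω, Real.exp (-(l * T ω)) ∂P = Real.exp (-t * l ^ θ)) :
    ∀ᵐ ω ∂P, 0 < T ω := by
  have h := lintegral_lintegral_rpow_mul_exp_lt_top hθ0 ht hT hT0 hL one_pos
  filter_upwards [hT0, ae_lt_top (Measurable.lintegral_prod_right'
    (ν := volume.restrict (Set.Ioi (0 : ℝ))) (f := fun z : Ω × ℝ =>
    ENNReal.ofReal (z.2 ^ ((1 : ℝ) - 1) * Real.exp (-(T z.1 * z.2)))) (by fun_prop)) h.ne]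
    with ω h0 hω
  refine h0.lt_of_ne fun he => hω.ne ?_
  simp [← he]

theorem integrable_rpow_neg_of_laplace {θ t : ℝ} (hθ0 : 0 < θ) (ht : 0 < t)
    (hT : Measurable T) (hT0 : ∀ᵐ ω ∂P, 0 ≤ T ω)
    (hL : ∀ l : ℝ, 0 ≤ l → ∫ ω, Real.exp (-(l * T ω)) ∂P = Real.exp (-t * l ^ θ))
    {p : ℝ} (hp : 0 < p) :
    Integrable (fun ω => T ω ^ (-p)) P := by
  have h := lintegral_lintegral_rpow_mul_exp_lt_top hθ0 ht hT hT0 hL hp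
  have hpos := ae_pos_of_laplace hθ0 ht hT hT0 hL
  have hΓ := Real.Gamma_pos_of_pos hp
  suffices hi : Integrable (fun ω => T ω ^ (-p) * Real.Gamma p) P by
    simpa [mul_assoc, hΓ.ne'] using hi.mul_const (Real.Gamma p)⁻¹
  refine ⟨((hT.pow_const (-p)).mul_const _).aestronglyMeasurable, ?_⟩
  rw [hasFiniteIntegral_iff_norm]
  refine lt_of_le_of_lt (le_of_eq (lintegral_congr_ae ?_)) h
  filter_upwards [hpos] with ω hω
  rw [lintegral_rpow_mul_exp_neg_mul hp hω, Real.norm_eq_abs,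
    abs_of_nonneg (mul_nonneg (Real.rpow_nonneg hω.le _) hΓ.le)]

end Laplace

theorem IsSubordinator.ae_nonneg {Ω : Type*} [MeasurableSpace Ω] {P : Measure Ω}
    {S : ℝ≥0 → Ω → ℝ} (hS : IsSubordinator S P) (t : ℝ≥0) : ∀ᵐ ω ∂P, 0 ≤ S t ω := by
  filter_upwards [hS.start_zero, hS.monotone_paths] with ω h0 hm
  rw [← h0]
  exact hm (zero_le)

/-! ### Euler's integral with a complex parameter -/

/-- Euler's integral for `Γ(p) / r^p` with a complex parameter `r`. Both sides are analytic in the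
half-plane `0 < Re r` (the left one as a moment generating function of `u^{p-1} du`), and they
agree for real `r`. -/
theorem integral_rpow_mul_cexp_neg_mul_Ioi {p : ℝ} (hp : 0 < p) {r : ℂ} (hr : 0 < r.re) :
    ∫ u in Set.Ioi (0 : ℝ), ((u ^ (p - 1) : ℝ) : ℂ) * Complex.exp (-r * u) =
      r ^ (-(p : ℂ)) * Real.Gamma p := by
  set μ : Measure ℝ := (volume.restrict (Set.Ioi (0 : ℝ))).withDensity
    fun u => ENNReal.ofReal (u ^ (p - 1)) with hμ
  have hm : Measurable fun u : ℝ => ENNReal.ofReal (u ^ (p - 1)) := by fun_prop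
  have hfin : ∀ᵐ u ∂(volume.restrict (Set.Ioi (0 : ℝ))), ENNReal.ofReal (u ^ (p - 1)) < ⊤ :=
    ae_of_all _ fun u => ENNReal.ofReal_lt_top
  have hsub : Set.Iio (0 : ℝ) ⊆ integrableExpSet id μ := by
    intro v hv
    change Integrable (fun u : ℝ => Real.exp (v * id u)) μ
    rw [hμ, integrable_withDensity_iff_integrable_smul' hm hfin]
    have h := integrableOn_rpow_mul_exp_neg_mul_rpow (s := p - 1) (b := -v) (by linarith) one_pos
      (neg_pos.2 hv)
    refine h.congr_fun (fun u hu => ?_) measurableSet_Ioi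
    simp [ENNReal.toReal_ofReal (Real.rpow_nonneg (le_of_lt hu) _)]
  have hmgf : ∀ z : ℂ, complexMGF id μ z =
      ∫ u in Set.Ioi (0 : ℝ), ((u ^ (p - 1) : ℝ) : ℂ) * Complex.exp (z * u) := by
    intro z
    rw [complexMGF, hμ, integral_withDensity_eq_integral_toReal_smul hm hfin]
    refine setIntegral_congr_fun measurableSet_Ioi fun u hu => ?_
    simp [ENNReal.toReal_ofReal (Real.rpow_nonneg (le_of_lt hu) _)]
  have hU : IsOpen {z : ℂ | z.re < 0} := isOpen_lt Complex.continuous_re continuous_const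
  have h1 : AnalyticOnNhd ℂ (complexMGF id μ) {z | z.re < 0} := by
    refine analyticOnNhd_complexMGF.mono fun z hz => ?_
    exact interior_maximal hsub isOpen_Iio hz
  have h2 : AnalyticOnNhd ℂ (fun z : ℂ => (-z) ^ (-(p : ℂ)) * Real.Gamma p) {z | z.re < 0} := by
    refine DifferentiableOn.analyticOnNhd (fun z hz => ?_) hU
    refine (DifferentiableAt.mul_const ?_ _).differentiableWithinAt
    exact DifferentiableAt.cpow_const differentiableAt_id.neg (Or.inl (by simpa using hz))
  have hconv : IsPreconnected {z : ℂ | z.re < 0} := (convex_halfSpace_re_lt 0).isPreconnected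
  have hreal : ∀ v : ℝ, 0 < v → complexMGF id μ ((-v : ℝ) : ℂ) =
      (-((-v : ℝ) : ℂ)) ^ (-(p : ℂ)) * Real.Gamma p := by
    intro v hv
    have h := Real.integral_rpow_mul_exp_neg_mul_Ioi hp hv
    have h' := congrArg (fun y : ℝ => (y : ℂ)) h
    rw [← integral_complex_ofReal] at h'
    rw [hmgf, Complex.ofReal_neg, neg_neg, ← Complex.ofReal_neg p, ← Complex.ofReal_cpow hv.le,
      Real.rpow_neg hv.le, ← Real.inv_rpow hv.le, ← one_div, ← Complex.ofReal_mul, ← h']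
    congr 1 with u
    push_cast
    ring_nf
  have hfreq : ∃ᶠ z in 𝓝[≠] (-1 : ℂ), complexMGF id μ z = (-z) ^ (-(p : ℂ)) * Real.Gamma p := by
    have ht : Tendsto (fun v : ℝ => ((-v : ℝ) : ℂ)) (𝓝[≠] 1) (𝓝[≠] (-1 : ℂ)) := by
      refine tendsto_nhdsWithin_of_tendsto_nhds_of_eventually_within _ ?_ ?_
      · refine Tendsto.mono_left ?_ nhdsWithin_le_nhds
        exact Continuous.tendsto' (by fun_prop) _ _ (by simp)
      · filter_upwards [self_mem_nhdsWithin] with v hv h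
        rw [Set.mem_singleton_iff] at h
        have : (v : ℂ) = 1 := by
          rw [Complex.ofReal_neg] at h
          exact neg_injective h
        exact hv (by exact_mod_cast this)
    refine ht.frequently (Eventually.frequently ?_)
    filter_upwards [mem_nhdsWithin_of_mem_nhds (lt_mem_nhds one_pos)] with v hv using hreal v hv
  have h := h1.eqOn_of_preconnected_of_frequently_eq h2 hconv (z₀ := -1) (by simp) hfreq
    (x := -r) (by simpa using hr)
  rw [hmgf] at h
  simpa using h

/-! ### Cosine transform of a stable characteristic function -/

theorem norm_cexp_neg_mul_rpow (a : ℂ) (β q : ℝ) :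
    ‖Complex.exp (-a * ((q ^ β : ℝ) : ℂ))‖ = Real.exp (-a.re * q ^ β) := by
  rw [Complex.norm_exp, Complex.re_mul_ofReal, Complex.neg_re]

theorem measurable_cexp_neg_mul_rpow (a : ℂ) (β : ℝ) :
    Measurable fun q : ℝ => Complex.exp (-a * ((q ^ β : ℝ) : ℂ)) := by
  fun_prop

theorem integrableOn_pow_mul_cexp_neg_mul_rpow {a : ℂ} (ha : 0 < a.re) {β : ℝ} (hβ : 0 < β)
    (m : ℕ) :
    IntegrableOn (fun q : ℝ => ((q ^ m : ℝ) : ℂ) * Complex.exp (-a * ((q ^ β : ℝ) : ℂ)))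
      (Set.Ioi 0) := by
  have h := integrableOn_rpow_mul_exp_neg_mul_rpow (s := m) (b := a.re)
    (by have : (0 : ℝ) ≤ m := m.cast_nonneg
        linarith) hβ ha
  refine Integrable.mono' h (Measurable.aestronglyMeasurable (by fun_prop)) ?_
  filter_upwards [ae_restrict_mem measurableSet_Ioi] with q hq
  rw [norm_mul, norm_cexp_neg_mul_rpow, Complex.norm_real, Real.norm_eq_abs,
    abs_of_nonneg (pow_nonneg (le_of_lt hq) _), Real.rpow_natCast]

/-- Substitute `u = q^β` in Euler's integral. -/
theorem integral_pow_mul_cexp_neg_mul_rpow {a : ℂ} (ha : 0 < a.re) {β : ℝ} (hβ : 0 < β) (m : ℕ) :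
    ∫ q in Set.Ioi (0 : ℝ), ((q ^ m : ℝ) : ℂ) * Complex.exp (-a * ((q ^ β : ℝ) : ℂ)) =
      ((β⁻¹ * Real.Gamma ((m + 1) / β) : ℝ) : ℂ) * a ^ (-(((m + 1) / β : ℝ) : ℂ)) := by
  have hp : 0 < ((m : ℝ) + 1) / β := by positivity
  have h := integral_rpow_mul_cexp_neg_mul_Ioi hp ha
  rw [← integral_comp_rpow_Ioi_of_pos hβ] at h
  have e : ∀ q ∈ Set.Ioi (0 : ℝ), (β * q ^ (β - 1)) •
      ((((q ^ β) ^ (((m : ℝ) + 1) / β - 1) : ℝ) : ℂ) * Complex.exp (-a * ((q ^ β : ℝ) : ℂ))) =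
      (β : ℂ) * (((q ^ m : ℝ) : ℂ) * Complex.exp (-a * ((q ^ β : ℝ) : ℂ))) := by
    intro q hq
    have hq : 0 < q := hq
    have : q ^ (β - 1) * (q ^ β) ^ (((m : ℝ) + 1) / β - 1) = q ^ m := by
      rw [← Real.rpow_mul hq.le, ← Real.rpow_add hq, ← Real.rpow_natCast]
      congr 1
      field_simp
      ring
    rw [← this, Complex.real_smul]
    push_cast
    ring
  rw [setIntegral_congr_fun measurableSet_Ioi e, integral_const_mul] at h
  have hβ' : (β : ℂ) ≠ 0 := by exact_mod_cast hβ.ne'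
  rw [Complex.ofReal_mul, Complex.ofReal_inv, mul_assoc, eq_inv_mul_iff_mul_eq₀ hβ', h]
  ring

/-- The bound on `φ` keeps `t e^{-iφ}` on the principal branch. -/
theorem re_mul_cexp_cpow_neg {t φ : ℝ} (ht : 0 < t) (hφ : |φ| < Real.pi) (c : ℝ) :
    (((t : ℂ) * Complex.exp (-Complex.I * φ)) ^ (-(c : ℂ))).re = t ^ (-c) * Real.cos (c * φ) := by
  have hφ' := abs_lt.1 hφ
  have e : -Complex.I * (φ : ℂ) = ((-φ : ℝ) : ℂ) * Complex.I := by push_cast; ring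
  have harg : Complex.arg ((t : ℂ) * Complex.exp (-Complex.I * φ)) = -φ := by
    rw [Complex.arg_real_mul _ ht, e, Complex.exp_mul_I, Complex.arg_cos_add_sin_mul_I]
    constructor <;> linarith
  rw [← Complex.ofReal_neg, Complex.cpow_ofReal_re, harg, norm_mul, e,
    Complex.norm_exp_ofReal_mul_I, Complex.norm_real, Real.norm_eq_abs, abs_of_pos ht, mul_one,
    neg_mul_neg, mul_comm φ c]

theorem integrableOn_exp_mul_exp_neg_mul_rpow (b : ℝ) {c β : ℝ} (hc : 0 < c) (hβ : 1 < β) :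
    IntegrableOn (fun q : ℝ => Real.exp (b * q) * Real.exp (-c * q ^ β)) (Set.Ioi 0) := by
  have hcont : Continuous fun q : ℝ => q ^ β := Real.continuous_rpow_const (by linarith)
  refine integrable_of_isBigO_exp_neg one_pos (Continuous.continuousOn (by fun_prop)) ?_
  have hlim : Tendsto (fun q : ℝ => c * q ^ (β - 1)) atTop atTop :=
    Tendsto.const_mul_atTop hc (tendsto_rpow_atTop (by linarith))
  refine Asymptotics.IsBigO.of_bound 1 ?_
  filter_upwards [hlim.eventually_ge_atTop (b + 1), eventually_gt_atTop 0] with q hq hq0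
  rw [one_mul, Real.norm_eq_abs, Real.norm_eq_abs, abs_of_pos (by positivity), Real.abs_exp,
    ← Real.exp_add, Real.exp_le_exp]
  have : q ^ β = q ^ (β - 1) * q := by
    rw [← Real.rpow_add_one hq0.ne']
    congr 1
    ring
  rw [this]
  nlinarith

/-- The cosine transform of `Re exp (-a q^β)`, `1 < β`, integrated term by term; the cosine series
is dominated by `cosh (q x) exp (-(Re a) q^β)`. -/
theorem hasSum_integral_cos_mul_re_cexp {a : ℂ} (ha : 0 < a.re) {β : ℝ} (hβ : 1 < β) (x : ℝ) :
    HasSum (fun k : ℕ => (-1) ^ k * x ^ (2 * k) / ((2 * k).factorial : ℝ) *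
        (β⁻¹ * Real.Gamma ((2 * k + 1) / β) * (a ^ (-(((2 * k + 1) / β : ℝ) : ℂ))).re))
      (∫ q in Set.Ioi (0 : ℝ),
        Real.cos (q * x) * (Complex.exp (-a * ((q ^ β : ℝ) : ℂ))).re) := by
  have hβ0 : 0 < β := by linarith
  have hterm : ∀ k : ℕ, ∫ q in Set.Ioi (0 : ℝ), (-1) ^ k * (q * x) ^ (2 * k) /
        ((2 * k).factorial : ℝ) * (Complex.exp (-a * ((q ^ β : ℝ) : ℂ))).re =
      (-1) ^ k * x ^ (2 * k) / ((2 * k).factorial : ℝ) *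
        (β⁻¹ * Real.Gamma ((2 * k + 1) / β) * (a ^ (-(((2 * k + 1) / β : ℝ) : ℂ))).re) := by
    intro k
    have h := integral_pow_mul_cexp_neg_mul_rpow ha hβ0 (2 * k)
    have h' := congrArg Complex.re h
    rw [← RCLike.re_eq_complex_re,
      ← integral_re (integrableOn_pow_mul_cexp_neg_mul_rpow ha hβ0 (2 * k)),
      RCLike.re_eq_complex_re, Complex.re_ofReal_mul] at h'
    push_cast at h'
    push_cast
    rw [← h', ← integral_const_mul]
    refine setIntegral_congr_fun measurableSet_Ioi fun q _ => ?_
    have := Complex.re_ofReal_mul (q ^ (2 * k)) (Complex.exp (-a * ((q ^ β : ℝ) : ℂ)))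
    push_cast at this
    rw [this]
    ring
  simp_rw [← hterm]
  have hcosh : ∀ q : ℝ, HasSum (fun k : ℕ => |q * x| ^ (2 * k) / ((2 * k).factorial : ℝ) *
      Real.exp (-a.re * q ^ β)) (Real.cosh (|q * x|) * Real.exp (-a.re * q ^ β)) :=
    fun q => (Real.hasSum_cosh _).mul_right _
  refine hasSum_integral_of_dominated_convergence
    (fun k q => |q * x| ^ (2 * k) / ((2 * k).factorial : ℝ) * Real.exp (-a.re * q ^ β))
    (fun k => Measurable.aestronglyMeasurable ?_) (fun k => ae_of_all _ fun q => ?_)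
    (ae_of_all _ fun q => (hcosh q).summable) ?_
    (ae_of_all _ fun q => (Real.hasSum_cos _).mul_right _)
  · exact Measurable.mul (by fun_prop)
      (Complex.measurable_re.comp (measurable_cexp_neg_mul_rpow a β))
  · rw [norm_mul, norm_div, norm_mul, norm_pow, norm_pow, norm_neg, norm_one, one_pow, one_mul,
      Real.norm_natCast, Real.norm_eq_abs (q * x), ← norm_cexp_neg_mul_rpow a β q]
    gcongr
    exact Complex.abs_re_le_norm _
  · simp_rw [fun q => (hcosh q).tsum_eq]
    refine Integrable.mono' (integrableOn_exp_mul_exp_neg_mul_rpow |x| ha hβ)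
      (Measurable.aestronglyMeasurable (by fun_prop)) ?_
    filter_upwards [ae_restrict_mem measurableSet_Ioi] with q hq
    rw [norm_mul, Real.norm_eq_abs, Real.norm_eq_abs, Real.abs_exp,
      abs_of_pos (Real.cosh_pos _), abs_mul, abs_of_pos hq, mul_comm q, Real.cosh_eq]
    gcongr
    have : -(|x| * q) ≤ |x| * q := by
      have := mul_nonneg (abs_nonneg x) (le_of_lt hq)
      linarith
    linarith [Real.exp_le_exp.2 this]

theorem neg_one_pow_mul_cos_eq_sin {α : ℝ} (hα : α ≠ 0) (k : ℕ) :
    (-1) ^ k * Real.cos (Real.pi * (2 * k + 1) / (2 * α)) =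
      Real.sin (Real.pi * ((2 * k + 1) * (α + 1) / (2 * α))) := by
  have e : Real.pi * ((2 * k + 1) * (α + 1) / (2 * α)) =
      Real.pi * (2 * k + 1) / (2 * α) + Real.pi / 2 + k * Real.pi := by
    field_simp
    ring
  rw [e, Real.sin_add_nat_mul_pi, Real.sin_add_pi_div_two]

/-- The parameter `t e^{-iπθ/2}` for which `exp (-(stableParam θ t) γ^θ)` is the characteristic
function at `γ > 0` of the stable law at time `t`. -/
noncomputable def stableParam (θ t : ℝ) : ℂ :=
  (t : ℂ) * Complex.exp (-Complex.I * ((Real.pi * θ / 2 : ℝ) : ℂ))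

theorem stableParam_re_pos {θ t : ℝ} (hθ0 : 0 < θ) (hθ1 : θ < 1) (ht : 0 < t) :
    0 < (stableParam θ t).re := by
  have e : -Complex.I * ((Real.pi * θ / 2 : ℝ) : ℂ) =
      ((-(Real.pi * θ / 2) : ℝ) : ℂ) * Complex.I := by push_cast; ring
  rw [stableParam, Complex.re_ofReal_mul, e, Complex.exp_ofReal_mul_I_re, Real.cos_neg]
  refine mul_pos ht (Real.cos_pos_of_mem_Ioo ?_)
  have := Real.pi_pos
  constructor <;> nlinarith

/-- The cosine transform of the real part of the characteristic function `γ ↦ E[exp (i γ S_t)]`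
of the stable law, evaluated along `γ = q^α`. -/
noncomputable def stableCosTransform (α θ t x : ℝ) : ℝ :=
  1 / Real.pi * ∫ q in Set.Ioi (0 : ℝ),
    Real.cos (q * x) * (Complex.exp (-stableParam θ t * ((q ^ (α * θ) : ℝ) : ℂ))).re

theorem hasSum_stableCosTransform {α θ t : ℝ} (hα : 0 < α) (hθ0 : 0 < θ) (hθ1 : θ < 1)
    (hαθ : 1 < α * θ) (ht : 0 < t) (x : ℝ) :
    HasSum (fun k : ℕ => 1 / (α * θ * Real.pi * t ^ (1 / (α * θ))) *
        ((x / t ^ (1 / (α * θ))) ^ (2 * k) *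
          (Real.Gamma ((2 * k + 1) / (α * θ)) / ((2 * k).factorial : ℝ)) *
          Real.sin (Real.pi * ((2 * k + 1) * (α + 1) / (2 * α)))))
      (stableCosTransform α θ t x) := by
  refine ((hasSum_integral_cos_mul_re_cexp (stableParam_re_pos hθ0 hθ1 ht) hαθ x).mul_left
    (1 / Real.pi)).congr_fun fun k => ?_
  have hpi := Real.pi_pos
  have hφ : |Real.pi * θ / 2| < Real.pi := by
    rw [abs_of_pos (by positivity)]
    nlinarith
  have hc : (2 * k + 1) / (α * θ) * (Real.pi * θ / 2) = Real.pi * (2 * k + 1) / (2 * α) := by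
    field_simp
  have hpow : t ^ (-((2 * k + 1) / (α * θ))) =
      (t ^ (1 / (α * θ)))⁻¹ * ((t ^ (1 / (α * θ))) ^ (2 * k))⁻¹ := by
    rw [← mul_inv, ← pow_succ', ← Real.rpow_natCast, ← Real.rpow_mul ht.le, Real.rpow_neg ht.le]
    congr 2
    push_cast
    ring
  have hpos : 0 < t ^ (1 / (α * θ)) := Real.rpow_pos_of_pos ht _
  rw [stableParam, re_mul_cexp_cpow_neg ht hφ, hc, hpow, ← neg_one_pow_mul_cos_eq_sin hα.ne',
    div_pow]
  field_simp

theorem norm_cos_mul_re_le (y : ℝ) (z : ℂ) : ‖Real.cos y * z.re‖ ≤ ‖z‖ := by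
  rw [norm_mul, Real.norm_eq_abs, Real.norm_eq_abs]
  exact (mul_le_of_le_one_left (abs_nonneg _) (Real.abs_cos_le_one _)).trans
    (Complex.abs_re_le_norm _)

theorem aestronglyMeasurable_cos_mul_re_cexp (a : ℂ) (β x : ℝ) :
    AEStronglyMeasurable (fun q : ℝ => Real.cos (q * x) *
      (Complex.exp (-a * ((q ^ β : ℝ) : ℂ))).re) (volume.restrict (Set.Ioi 0)) :=
  (Measurable.mul (by fun_prop)
    (Complex.measurable_re.comp (measurable_cexp_neg_mul_rpow a β))).aestronglyMeasurable

theorem integrableOn_norm_cexp_neg_mul_rpow {a : ℂ} (ha : 0 < a.re) {β : ℝ} (hβ : 0 < β) :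
    IntegrableOn (fun q : ℝ => ‖Complex.exp (-a * ((q ^ β : ℝ) : ℂ))‖) (Set.Ioi 0) := by
  simpa using! (integrableOn_pow_mul_cexp_neg_mul_rpow ha hβ 0).norm

theorem integrableOn_cos_mul_re_cexp {a : ℂ} (ha : 0 < a.re) {β : ℝ} (hβ : 0 < β) (x : ℝ) :
    IntegrableOn (fun q : ℝ => Real.cos (q * x) *
      (Complex.exp (-a * ((q ^ β : ℝ) : ℂ))).re) (Set.Ioi 0) :=
  Integrable.mono' (integrableOn_norm_cexp_neg_mul_rpow ha hβ)
    (aestronglyMeasurable_cos_mul_re_cexp a β x) (ae_of_all _ fun _ => norm_cos_mul_re_le _ _)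

theorem continuous_stableCosTransform {α θ t : ℝ} (hθ0 : 0 < θ) (hθ1 : θ < 1)
    (hαθ : 1 < α * θ) (ht : 0 < t) : Continuous (stableCosTransform α θ t) :=
  (continuous_of_dominated (fun x => aestronglyMeasurable_cos_mul_re_cexp _ _ x)
    (fun _ => ae_of_all _ fun _ => norm_cos_mul_re_le _ _)
    (integrableOn_norm_cexp_neg_mul_rpow (stableParam_re_pos hθ0 hθ1 ht) (by linarith))
    (ae_of_all _ fun q => by fun_prop)).const_mul _

/-! ### The subordinated density -/

section Mixture

variable {Ω : Type*} [MeasurableSpace Ω] {P : Measure Ω} {T : Ω → ℝ} {α : ℝ}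

/-- Measurability in `(x, ω)` of `u_{2α}(x, T ω)`, as a limit of jointly continuous functions
of `(x, T ω)`. -/
theorem aestronglyMeasurable_uncurry_fresnelDensity [SFinite P] (hα : 1 < α) (hT : Measurable T)
    (hpos : ∀ᵐ ω ∂P, 0 < T ω) (ν : Measure ℝ) [SFinite ν] :
    AEStronglyMeasurable (fun p : ℝ × Ω => fresnelDensity α p.1 (T p.2)) (ν.prod P) := by
  refine aestronglyMeasurable_of_tendsto_ae atTop
    (f := fun n (p : ℝ × Ω) => fresnelPartial α n p.1 (T p.2)) (fun n => ?_) ?_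
  · exact ((continuous_fresnelPartial hα n).measurable.comp
      (by fun_prop : Measurable fun p : ℝ × Ω => (p.1, T p.2))).aestronglyMeasurable
  · filter_upwards [Measure.quasiMeasurePreserving_snd.ae hpos] with p hp
    exact tendsto_fresnelPartial hα hp p.1

variable [IsProbabilityMeasure P]

theorem integrable_fresnelBound (hint : Integrable (fun ω => T ω ^ (-(1 / (α - 1)))) P) (M : ℝ) :
    Integrable (fun ω => ((M + 1) / α) ^ (1 / (α - 1)) * T ω ^ (-(1 / (α - 1))) + 2) P :=
  (hint.const_mul _).add (integrable_const _)

/-- The improper integral defining `u_{2α}` commutes with the expectation, the partial integrals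
being dominated by a negative power of `T`. -/
theorem tendsto_integral_fresnelPartial (hα : 1 < α) (hT : Measurable T)
    (hpos : ∀ᵐ ω ∂P, 0 < T ω) (hint : Integrable (fun ω => T ω ^ (-(1 / (α - 1)))) P) (x : ℝ) :
    Tendsto (fun n => ∫ ω, fresnelPartial α n x (T ω) ∂P) atTop
      (𝓝 (subordinatedFresnelDensity α T P x)) := by
  refine tendsto_integral_of_dominated_convergence _ (fun n => ?_)
    (integrable_fresnelBound hint |x|) (fun n => ?_) ?_
  · exact ((continuous_fresnelPartial hα n).measurable.comp
      (by fun_prop : Measurable fun ω => (x, T ω))).aestronglyMeasurable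
  · filter_upwards [hpos] with ω hω using abs_fresnelPartial_le hα hω le_rfl n
  · filter_upwards [hpos] with ω hω using tendsto_fresnelPartial hα hω x

theorem integrable_fresnelDensity (hα : 1 < α) (hT : Measurable T)
    (hpos : ∀ᵐ ω ∂P, 0 < T ω) (hint : Integrable (fun ω => T ω ^ (-(1 / (α - 1)))) P) (x : ℝ) :
    Integrable (fun ω => fresnelDensity α x (T ω)) P := by
  refine Integrable.mono' (integrable_fresnelBound hint |x|)
    (aestronglyMeasurable_of_tendsto_ae atTop
      (f := fun n ω => fresnelPartial α n x (T ω)) (fun n => ?_) ?_) ?_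
  · exact ((continuous_fresnelPartial hα n).measurable.comp
      (by fun_prop : Measurable fun ω => (x, T ω))).aestronglyMeasurable
  · filter_upwards [hpos] with ω hω using tendsto_fresnelPartial hα hω x
  · filter_upwards [hpos] with ω hω using abs_fresnelDensity_le hα hω le_rfl

theorem integrable_uncurry_fresnelDensity (hα : 1 < α) (hT : Measurable T)
    (hpos : ∀ᵐ ω ∂P, 0 < T ω) (hint : Integrable (fun ω => T ω ^ (-(1 / (α - 1)))) P) (a b : ℝ) :
    Integrable (fun p : ℝ × Ω => fresnelDensity α p.1 (T p.2))
      ((volume.restrict (Set.Icc a b)).prod P) := by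
  refine Integrable.mono' ((integrable_fresnelBound hint (max |a| |b|)).comp_snd _)
    (aestronglyMeasurable_uncurry_fresnelDensity hα hT hpos _) ?_
  filter_upwards [Measure.quasiMeasurePreserving_snd.ae hpos,
    Measure.quasiMeasurePreserving_fst.ae (ae_restrict_mem measurableSet_Icc)] with p hp hx
  exact abs_fresnelDensity_le hα hp (abs_le_max_abs_abs hx.1 hx.2)

/-- The expectation of the partial integral, by Fubini on the bounded range of integration. -/
theorem integral_fresnelPartial (hT : Measurable T) (n : ℕ) (x : ℝ) :
    ∫ ω, fresnelPartial α n x (T ω) ∂P =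
      1 / Real.pi * ∫ q in (0 : ℝ)..n, Real.cos (q * x) *
        ∫ ω, Real.cos (T ω * q ^ α) ∂P := by
  simp_rw [fresnelPartial, integral_const_mul,
    intervalIntegral.integral_of_le (Nat.cast_nonneg (α := ℝ) n)]
  rw [integral_integral_swap]
  · simp_rw [integral_const_mul]
  · refine Integrable.of_bound (C := 1) (Measurable.aestronglyMeasurable ?_)
      (ae_of_all _ fun p => ?_)
    · unfold Function.uncurry
      fun_prop
    · simp only [Function.uncurry, norm_mul, Real.norm_eq_abs]
      exact mul_le_one₀ (Real.abs_cos_le_one _) (abs_nonneg _) (Real.abs_cos_le_one _)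

/-- The real part of the characteristic function at `γ = q^α`. -/
theorem integral_cos_mul_of_charFun {θ t : ℝ} (hT : Measurable T)
    (hchar : ∀ γ : ℝ, ∫ ω, Complex.exp (Complex.I * γ * T ω) ∂P =
      Complex.exp (-(t : ℂ) * ((|γ| ^ θ : ℝ) : ℂ) *
        Complex.exp (-Complex.I * ((Real.pi * θ / 2 * Real.sign γ : ℝ) : ℂ))))
    {q : ℝ} (hq : 0 < q) :
    ∫ ω, Real.cos (T ω * q ^ α) ∂P =
      (Complex.exp (-stableParam θ t * ((q ^ (α * θ) : ℝ) : ℂ))).re := by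
  have hqα : 0 < q ^ α := Real.rpow_pos_of_pos hq _
  have e : ∀ ω, Complex.I * ((q ^ α : ℝ) : ℂ) * T ω = ((T ω * q ^ α : ℝ) : ℂ) * Complex.I := by
    intro ω; push_cast; ring
  have hi : Integrable (fun ω => Complex.exp (Complex.I * ((q ^ α : ℝ) : ℂ) * T ω)) P := by
    refine Integrable.of_bound (C := 1) (Measurable.aestronglyMeasurable (by fun_prop))
      (ae_of_all _ fun ω => ?_)
    rw [e, Complex.norm_exp_ofReal_mul_I]
  have h := congrArg Complex.re (hchar (q ^ α))
  rw [← RCLike.re_eq_complex_re, ← integral_re hi, RCLike.re_eq_complex_re, abs_of_pos hqα,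
    Real.sign_of_pos hqα, ← Real.rpow_mul hq.le, mul_one] at h
  rw [stableParam]
  convert! h using 2
  · ext ω
    rw [e, Complex.exp_ofReal_mul_I_re]
  · congr 1
    ring

/-- Pass to the limit in the partial integrals: the expectation by domination, the cosine transform
because the characteristic function is integrable along `γ = q^α`. -/
theorem subordinatedFresnelDensity_eq_stableCosTransform {θ t : ℝ} (hα : 1 < α) (hθ0 : 0 < θ)
    (hθ1 : θ < 1) (ht : 0 < t) (hT : Measurable T)
    (hpos : ∀ᵐ ω ∂P, 0 < T ω) (hint : Integrable (fun ω => T ω ^ (-(1 / (α - 1)))) P)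
    (hchar : ∀ γ : ℝ, ∫ ω, Complex.exp (Complex.I * γ * T ω) ∂P =
      Complex.exp (-(t : ℂ) * ((|γ| ^ θ : ℝ) : ℂ) *
        Complex.exp (-Complex.I * ((Real.pi * θ / 2 * Real.sign γ : ℝ) : ℂ)))) :
    subordinatedFresnelDensity α T P = stableCosTransform α θ t := by
  ext x
  refine tendsto_nhds_unique (tendsto_integral_fresnelPartial hα hT hpos hint x) ?_
  have h := (intervalIntegral_tendsto_integral_Ioi 0 (integrableOn_cos_mul_re_cexp
    (stableParam_re_pos hθ0 hθ1 ht) (by positivity : 0 < α * θ) x)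
    (tendsto_natCast_atTop_atTop (R := ℝ))).const_mul (1 / Real.pi)
  refine h.congr fun n => ?_
  rw [integral_fresnelPartial hT]
  congr 1
  rw [intervalIntegral.integral_of_le n.cast_nonneg, intervalIntegral.integral_of_le n.cast_nonneg]
  refine setIntegral_congr_fun measurableSet_Ioc fun q hq => ?_
  rw [integral_cos_mul_of_charFun hT hchar hq.1]

end Mixture

theorem mainTheorem5 {Ω : Type*} [MeasurableSpace Ω] (P : Measure Ω) [IsProbabilityMeasure P]
    (α θ : ℝ) (hα : 1 < α) (hθ0 : 0 < θ) (hθ1 : θ < 1) (hαθ : 1 < α * θ)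
    (S : ℝ≥0 → Ω → ℝ) (hS : IsStableSubordinator θ S P) (t : ℝ≥0) (ht : 0 < t) :
    -- the mixture integral converges absolutely, the power series converges, and they agree
    (∀ x : ℝ,
      Integrable (fun ω => fresnelDensity α x (S t ω)) P ∧
      Summable (fun k : ℕ => (x / (t : ℝ) ^ (1 / (α * θ))) ^ (2 * k) *
        (Real.Gamma ((2 * k + 1) / (α * θ)) / ((2 * k).factorial : ℝ)) *
        Real.sin (Real.pi * ((2 * k + 1) * (α + 1) / (2 * α)))) ∧
      subordinatedFresnelDensity α (S t) P x =
        1 / (α * θ * Real.pi * (t : ℝ) ^ (1 / (α * θ))) *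
          ∑' k : ℕ, (x / (t : ℝ) ^ (1 / (α * θ))) ^ (2 * k) *
            (Real.Gamma ((2 * k + 1) / (α * θ)) / ((2 * k).factorial : ℝ)) *
            Real.sin (Real.pi * ((2 * k + 1) * (α + 1) / (2 * α)))) ∧
    -- this function is the density of the pseudo-law of the subordinated pseudoprocess
    Continuous (subordinatedFresnelDensity α (S t) P) ∧
    (∀ a b : ℝ, a ≤ b →
      Integrable (fun ω => fresnelProb α (S t ω) a b) P ∧
      subordinatedFresnelProb α (S t) P a b =
        ∫ x in Set.Icc a b, subordinatedFresnelDensity α (S t) P x) := by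
  have ht' : (0 : ℝ) < t := by exact_mod_cast ht
  have hT := hS.measurable t
  have hT0 := hS.ae_nonneg t
  have hchar := hS.charFun_eq t
  have hL : ∀ l : ℝ, 0 ≤ l → ∫ ω, Real.exp (-(l * S t ω)) ∂P = Real.exp (-(t : ℝ) * l ^ θ) :=
    fun l hl => integral_exp_neg_mul_of_charFun hθ0 hθ1 ht'.le hT hT0 hchar hl
  have hpos := ae_pos_of_laplace hθ0 ht' hT hT0 hL
  have hint := integrable_rpow_neg_of_laplace hθ0 ht' hT hT0 hL
    (p := 1 / (α - 1)) (one_div_pos.2 (by linarith))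
  have hdens := subordinatedFresnelDensity_eq_stableCosTransform hα hθ0 hθ1 ht' hT hpos hint hchar
  refine ⟨fun x => ?_, ?_, fun a b _ => ?_⟩
  · have hsum := hasSum_stableCosTransform (by linarith) hθ0 hθ1 hαθ ht' x
    have hC : 1 / (α * θ * Real.pi * (t : ℝ) ^ (1 / (α * θ))) ≠ 0 := by
      have := Real.rpow_pos_of_pos ht' (1 / (α * θ))
      have := Real.pi_pos
      positivity
    refine ⟨integrable_fresnelDensity hα hT hpos hint x, ?_, ?_⟩
    · exact (summable_mul_left_iff hC).1 hsum.summable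
    · rw [hdens, ← tsum_mul_left, hsum.tsum_eq]
  · rw [hdens]
    exact continuous_stableCosTransform hθ0 hθ1 hαθ ht'
  · have hi := integrable_uncurry_fresnelDensity hα hT hpos hint a b
    constructor
    · simp_rw [fresnelProb_eq]
      exact hi.integral_prod_right
    · simp_rw [subordinatedFresnelProb, fresnelProb_eq]
      exact (integral_integral_swap hi).symm
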